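/- A $(0,1)$-matrix is *lonesum* if it is the only $(0,1)$-matrix with its row sums and column sums. For matrices of the same size write $A\sim B$ if $A$ is obtained from $B$ by permuting rows and permuting columns. A $(0,1)$-matrix $A$ is *lonesum decomposable* if $A\sim\operatorname{diag}(L_1,\dots,L_k)$, a (rectangular) block diagonal matrix with lonesum blocks $L_i$. A $(0,1)$-matrix is a *Ferrers matrix* if all entries below a $0$ in its column and all entries to the right of a $0$ in its row are $0$. A lonesum decomposable matrix $A$ has *decomposition order* $k\ge 0$ if $A\sim\operatorname{diag}(F_1,\dots,F_k,O)$, where $F_1,\dots,F_k$ are non-empty Ferrers matrices with no zero rows and no zero columns and $O$ is a zero matrix, possibly with no rows or no columns. For integers $k,m,n\ge 0$ let $D_k(m,n)$ be the number of $m\times n$ lonesum decomposable matrices of decomposition order $k$, and let $D(m,n)$ be the number of all $m\times n$ lonesum decomposable matrices. For $m=0$ or $n=0$ there is exactly one $m\times n$ matrix; it is lonesum decomposable of order $0$, so that $D_0(m,n)=1$ and $D_k(m,n)=0$ for $k\ge1$. **Theorem.** As formal power series in $x,y$ over $\mathbb{Q}$, $$\sum_{m=0}^{\infty}\sum_{n=0}^{\infty}D_k(m,n)\frac{x^m}{m!}\frac{y^n}{n!}=\frac{e^{x+y}}{k!}\left(\frac{1}{e^x+e^y-e^{x+y}}-1\right)^k\qquad\text{for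 every integer }k\ge 0.$$ Moreover $D(m,n)=\sum_{k=0}^{\infty}D_k(m,n)$ for all $m,n\ge 0$, and $$\sum_{m=0}^{\infty}\sum_{n=0}^{\infty}D(m,n)\frac{x^m}{m!}\frac{y^n}{n!}=\exp\left(\frac{1}{e^x+e^y-e^{x+y}}+x+y-1\right).$$ -/

import Mathlib

namespace Lonesum

/-- A `(0,1)`-matrix: every entry is `0` or `1`. -/
abbrev BinMatrix (α β : Type) := Matrix α β (Fin 2)

/-- `A` is a lonesum matrix: it is the only `(0,1)`-matrix with its row and column sums
(the sums are taken in `ℕ`). -/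
def IsLonesum {α β : Type} [Fintype α] [Fintype β] (A : BinMatrix α β) : Prop :=
  ∀ B : BinMatrix α β,
    (∀ i, ∑ j, (B i j : ℕ) = ∑ j, (A i j : ℕ)) →
    (∀ j, ∑ i, (B i j : ℕ) = ∑ i, (A i j : ℕ)) → B = A

/-- Ferrers matrices: below and to the right of a `0` there are only `0`s. -/
def IsFerrers {p q : ℕ} (A : BinMatrix (Fin p) (Fin q)) : Prop :=
  ∀ i j, A i j = 0 → (∀ k, i ≤ k → A k j = 0) ∧ (∀ l, j ≤ l → A i l = 0)

/-- No row and no column of `A` is zero. -/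
def NoZeroRowCol {α β : Type} (A : BinMatrix α β) : Prop :=
  (∀ i, ∃ j, A i j ≠ 0) ∧ (∀ j, ∃ i, A i j ≠ 0)

/-- `A` becomes the matrix `B` after a permutation of rows and a permutation of columns.
The matrices may be indexed by different types (e.g. `B` in block form), so the
permutations are bijections between the index types. -/
def PermEquiv {α β α' β' : Type} (A : BinMatrix α β) (B : BinMatrix α' β') : Prop :=
  ∃ (e : α ≃ α') (f : β ≃ β'), A = B.submatrix e f

/-- `A` is lonesum decomposable: up to permutations of rows and columns it is
block diagonal with lonesum diagonal blocks `L 0, …, L (k-1)`, where `L i` has size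
`p i × q i`. -/
def IsLonesumDecomposable {m n : ℕ} (A : BinMatrix (Fin m) (Fin n)) : Prop :=
  ∃ (k : ℕ) (p q : Fin k → ℕ) (L : ∀ i, BinMatrix (Fin (p i)) (Fin (q i))),
    (∀ i, IsLonesum (L i)) ∧ PermEquiv A (Matrix.blockDiagonal' L)

/-- `A` has decomposition order `k`: up to permutations of rows and columns it is
`diag (F 0, …, F (k-1), O)`, where the `F i` are non-empty Ferrers matrices with no zero rows
and no zero columns, and `O` is a zero matrix of some size `r × s`
(`r = 0` or `s = 0` is allowed). -/
def HasDecompositionOrder {m n : ℕ} (A : BinMatrix (Fin m) (Fin n)) (k : ℕ) : Prop :=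
  ∃ (p q : Fin k → ℕ) (F : ∀ i, BinMatrix (Fin (p i)) (Fin (q i))) (r s : ℕ),
    (∀ i, 0 < p i ∧ 0 < q i ∧ IsFerrers (F i) ∧ NoZeroRowCol (F i)) ∧
    PermEquiv A
      (Matrix.fromBlocks (Matrix.blockDiagonal' F) 0 0 (0 : BinMatrix (Fin r) (Fin s)))

/-- `D_k(m,n)`: the number of `m × n` lonesum decomposable matrices of decomposition
order `k`. -/
noncomputable def numDecomposableOfOrder (k m n : ℕ) : ℕ :=
  Nat.card {A : BinMatrix (Fin m) (Fin n) //
    IsLonesumDecomposable A ∧ HasDecompositionOrder A k}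

/-- `D(m,n)`: the number of all `m × n` lonesum decomposable matrices. -/
noncomputable def numDecomposable (m n : ℕ) : ℕ :=
  Nat.card {A : BinMatrix (Fin m) (Fin n) // IsLonesumDecomposable A}

/-- The double exponential generating function
`∑ₘ ∑ₙ a(m,n) x^m/m! y^n/n!`, as a formal power series in the two variables
`x = X 0`, `y = X 1` (a power series is its function of coefficients). -/
noncomputable def doubleEGF (a : ℕ → ℕ → ℕ) : MvPowerSeries (Fin 2) ℚ :=
  fun d => (a (d 0) (d 1) : ℚ) / ((d 0).factorial * (d 1).factorial)

/-- The formal exponential `exp(f) = ∑ᵢ f^i/i!` of a power series `f`; it is only used for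
`f` with constant coefficient `0`, where the substitution makes sense. -/
noncomputable def expOf (f : MvPowerSeries (Fin 2) ℚ) : MvPowerSeries (Fin 2) ℚ :=
  (PowerSeries.exp ℚ).subst f

/-- The variable `x`. -/
noncomputable def x : MvPowerSeries (Fin 2) ℚ := MvPowerSeries.X 0

/-- The variable `y`. -/
noncomputable def y : MvPowerSeries (Fin 2) ℚ := MvPowerSeries.X 1

/-- The formal power series `1 / (e^x + e^y - e^{x+y})`; the denominator has constant
coefficient `1`. -/
noncomputable def kernelSeries : MvPowerSeries (Fin 2) ℚ :=
  (expOf x + expOf y - expOf (x + y))⁻¹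

end Lonesum

/-! ### Double exponential generating functions and the formal exponential -/

namespace Lonesum

open Finset

/-! Read a matrix as the relation given by its nonzero entries. A matrix is lonesum exactly when its
rows are nested, i.e. no 2×2 submatrix is a permutation matrix (`IsLonesum.nested`,
`Nested.isLonesum`); sorting rows and columns by size makes a nested relation Ferrers. Nonempty
nested pieces without empty rows or columns cannot be split further, so they are intrinsic "blocks"
of the relation. Decomposable then means that every related pair lies in a block, and the order is
the number of blocks (`isLonesumDecomposable_iff`, `hasDecompositionOrder_iff`).

A product of double EGFs counts relations with a marked splitting into two parts
(`RelClass.doubleEGF_count_mul`). Let P be the EGF of nested relations with no empty row or column.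
Adding empty rows, empty columns, or both shows that P·e^x, P·e^y and P·e^(x+y) count nested
relations with no empty column, with no empty row, and without restriction. Complementation
exchanges "no empty row and no empty column" with "an empty row and an empty column", except in size
0×0, so inclusion–exclusion gives P·(e^x + e^y - e^(x+y)) = 1 (`card_colFull_add_card_rowFull`): P
is the kernel series.

Marking one block of a relation with k+1 blocks gives (P - 1)·B_k = (k+1)·B_(k+1)
(`isSplit_connNested_blockClass`), with B_0 = e^(x+y). Summing over k gives the exponential. -/

theorem sum_powerset_card_compl {M : Type*} [AddCommMonoid M] (m : ℕ) (f : ℕ → ℕ → M) :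
    ∑ S : Finset (Fin m), f S.card (m - S.card) =
      ∑ p ∈ antidiagonal m, m.choose p.1 • f p.1 p.2 := by
  have h := sum_powerset_apply_card (fun i => f i (m - i)) (x := (univ : Finset (Fin m)))
  rw [powerset_univ, card_univ, Fintype.card_fin] at h
  rw [h, Nat.sum_antidiagonal_eq_sum_range_succ_mk]

theorem sum_antidiagonal_finsupp_fin_two {M : Type*} [AddCommMonoid M] (d : Fin 2 →₀ ℕ)
    (f : ℕ → ℕ → ℕ → ℕ → M) :
    ∑ p ∈ antidiagonal d, f (p.1 0) (p.1 1) (p.2 0) (p.2 1) =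
      ∑ u ∈ antidiagonal (d 0), ∑ v ∈ antidiagonal (d 1), f u.1 v.1 u.2 v.2 := by
  rw [← sum_product']
  let mk : ℕ → ℕ → (Fin 2 →₀ ℕ) := fun a b => Finsupp.equivFunOnFinite.symm ![a, b]
  refine sum_bij' (fun p _ => ((p.1 0, p.2 0), (p.1 1, p.2 1)))
    (fun q _ => (mk q.1.1 q.2.1, mk q.1.2 q.2.2)) ?_ ?_ ?_ ?_ ?_
  · intro p hp
    rw [HasAntidiagonal.mem_antidiagonal] at hp
    simp [← hp]
  · intro q hq
    simp only [mem_product, HasAntidiagonal.mem_antidiagonal] at hq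
    rw [HasAntidiagonal.mem_antidiagonal]
    ext i
    fin_cases i <;> simp [mk, hq]
  · intro p hp
    ext i <;> fin_cases i <;> simp [mk]
  · intro q hq
    simp [mk]
  · intro p hp
    rfl

theorem coeff_doubleEGF (a : ℕ → ℕ → ℕ) (d : Fin 2 →₀ ℕ) :
    MvPowerSeries.coeff d (doubleEGF a) =
      (a (d 0) (d 1) : ℚ) / ((d 0).factorial * (d 1).factorial) := rfl

/-- Binomial convolution in both variables: the binomial coefficients count the subsets S and T of
given sizes. -/
theorem doubleEGF_mul (a b : ℕ → ℕ → ℕ) :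
    doubleEGF a * doubleEGF b = doubleEGF fun m n =>
      ∑ S : Finset (Fin m), ∑ T : Finset (Fin n),
        a S.card T.card * b (m - S.card) (n - T.card) := by
  ext d
  rw [MvPowerSeries.coeff_mul]
  simp only [coeff_doubleEGF]
  rw [sum_antidiagonal_finsupp_fin_two d (fun i j i' j' =>
    (a i j : ℚ) / (i.factorial * j.factorial) * ((b i' j' : ℚ) / (i'.factorial * j'.factorial)))]
  simp_rw [fun S : Finset (Fin (d 0)) => sum_powerset_card_compl (d 1)
    (fun j j' => a S.card j * b (d 0 - S.card) j')]
  rw [sum_powerset_card_compl (d 0) (fun i i' => ∑ p ∈ antidiagonal (d 1),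
    (d 1).choose p.1 • (a i p.1 * b i' p.2))]
  push_cast
  rw [sum_div]
  refine sum_congr rfl fun u hu => ?_
  simp only [nsmul_eq_mul, Nat.cast_id, Nat.cast_mul, Nat.cast_sum, mul_sum, sum_div]
  refine sum_congr rfl fun v hv => ?_
  rw [HasAntidiagonal.mem_antidiagonal] at hu hv
  rw [← hu, ← hv, Nat.cast_add_choose, Nat.cast_add_choose]
  have h1 : ∀ n : ℕ, (n.factorial : ℚ) ≠ 0 := fun n => by exact_mod_cast n.factorial_ne_zero
  have := h1 u.1
  have := h1 u.2
  have := h1 v.1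
  have := h1 v.2
  have := h1 (u.1 + u.2)
  have := h1 (v.1 + v.2)
  field_simp

theorem doubleEGF_add (a b : ℕ → ℕ → ℕ) :
    doubleEGF a + doubleEGF b = doubleEGF fun m n => a m n + b m n := by
  ext d
  simp only [map_add, coeff_doubleEGF]
  push_cast
  ring

theorem doubleEGF_zero_zero :
    doubleEGF (fun m n => if m = 0 ∧ n = 0 then 1 else 0) = 1 := by
  ext d
  rw [coeff_doubleEGF, MvPowerSeries.coeff_one]
  have : d = 0 ↔ d 0 = 0 ∧ d 1 = 0 := by
    simp [Finsupp.ext_iff, Fin.forall_fin_two]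
  by_cases h : d = 0
  · simp [h]
  · rw [if_neg h, if_neg (this.not.mp h)]
    simp

theorem coeff_expOf_X (i : Fin 2) (d : Fin 2 →₀ ℕ) :
    MvPowerSeries.coeff d (expOf (MvPowerSeries.X i)) =
      if d = Finsupp.single i (d i) then 1 / ((d i).factorial : ℚ) else 0 := by
  rw [expOf, PowerSeries.coeff_subst_single]
  simp [PowerSeries.coeff_exp]

theorem expOf_x : expOf x = doubleEGF fun _ n => if n = 0 then 1 else 0 := by
  ext d
  rw [x, coeff_expOf_X, coeff_doubleEGF]
  have : d = Finsupp.single 0 (d 0) ↔ d 1 = 0 := by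
    simp [Finsupp.ext_iff, Fin.forall_fin_two]
  by_cases h : d 1 = 0
  · rw [if_pos (this.mpr h), h]
    simp
  · rw [if_neg (this.not.mpr h), if_neg h]
    simp

theorem expOf_y : expOf y = doubleEGF fun m _ => if m = 0 then 1 else 0 := by
  ext d
  rw [y, coeff_expOf_X, coeff_doubleEGF]
  have : d = Finsupp.single 1 (d 1) ↔ d 0 = 0 := by
    simp [Finsupp.ext_iff, Fin.forall_fin_two]
  by_cases h : d 0 = 0
  · rw [if_pos (this.mpr h), h]
    simp
  · rw [if_neg (this.not.mpr h), if_neg h]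
    simp

theorem expOf_x_add_y : expOf (x + y) = doubleEGF fun _ _ => 1 := by
  ext d
  rw [x, y, expOf, PowerSeries.coeff_subst_X_zero_add_X_one, coeff_doubleEGF]
  rw [PowerSeries.coeff_exp, Nat.cast_add_choose]
  have h1 : ∀ n : ℕ, (n.factorial : ℚ) ≠ 0 := fun n => by exact_mod_cast n.factorial_ne_zero
  have := h1 (d 0)
  have := h1 (d 1)
  have := h1 (d 0 + d 1)
  simp
  field_simp

theorem hasSubst_of_constantCoeff {f : MvPowerSeries (Fin 2) ℚ}
    (hf : MvPowerSeries.constantCoeff f = 0) : PowerSeries.HasSubst f :=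
  PowerSeries.HasSubst.of_constantCoeff_zero hf

theorem expOf_x_mul_expOf_y : expOf x * expOf y = expOf (x + y) := by
  rw [expOf_x, expOf_y, expOf_x_add_y, doubleEGF_mul]
  congr 1
  ext m n
  -- The first factor forces T to be empty and the second forces S to be everything.
  rw [sum_eq_single univ, sum_eq_single ∅]
  · simp
  · intro T _ hT
    simp [hT]
  · simp
  · intro S _ hS
    have : m - S.card ≠ 0 := by
      have := (card_lt_iff_ne_univ S).mpr hS
      simp at this
      omega
    simp [this]
  · simp

/-- Substituting f for x and g for y in e^x·e^y = e^(x+y) gives the general law. -/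
theorem expOf_add {f g : MvPowerSeries (Fin 2) ℚ} (hf : MvPowerSeries.constantCoeff f = 0)
    (hg : MvPowerSeries.constantCoeff g = 0) : expOf (f + g) = expOf f * expOf g := by
  let s : Fin 2 → MvPowerSeries (Fin 2) ℚ := ![f, g]
  have hs : MvPowerSeries.HasSubst s := by
    apply MvPowerSeries.hasSubst_of_constantCoeff_zero
    intro i
    fin_cases i
    · exact hf
    · exact hg
  have key : ∀ h : MvPowerSeries (Fin 2) ℚ, MvPowerSeries.constantCoeff h = 0 →
      MvPowerSeries.subst s (expOf h) = expOf (MvPowerSeries.subst s h) := by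
    intro h hh
    exact MvPowerSeries.subst_comp_subst_apply
      (hasSubst_of_constantCoeff hh).const hs _
  have h := congrArg (MvPowerSeries.subst s) expOf_x_mul_expOf_y
  rw [MvPowerSeries.subst_mul hs, key _ (by simp [x]), key _ (by simp [y]),
    key _ (by simp [x, y]), MvPowerSeries.subst_add hs, x, y, MvPowerSeries.subst_X hs,
    MvPowerSeries.subst_X hs] at h
  exact h.symm

theorem coeff_expOf {f : MvPowerSeries (Fin 2) ℚ} (hf : MvPowerSeries.constantCoeff f = 0)
    (d : Fin 2 →₀ ℕ) (N : ℕ) (hN : ∀ k, N ≤ k → MvPowerSeries.coeff d (f ^ k) = 0) :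
    MvPowerSeries.coeff d (expOf f) =
      ∑ k ∈ range N, (1 / (k.factorial : ℚ)) * MvPowerSeries.coeff d (f ^ k) := by
  rw [expOf, PowerSeries.coeff_subst (hasSubst_of_constantCoeff hf),
    finsum_eq_sum_of_support_subset (s := range N)]
  · simp [PowerSeries.coeff_exp]
  · intro k hk
    by_contra h
    apply hk
    simp at h
    simp [hN k h]

end Lonesum

/-! ### Classes of relations and the product principle -/

namespace Lonesum

/-- An isomorphism-invariant class of relations between two types. -/
structure RelClass where
  /-- Membership in the class. -/
  holds : ∀ {α β : Type}, (α → β → Prop) → Prop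
  /-- The class is invariant under relabelling. -/
  iso : ∀ {α β α' β' : Type} (e : α ≃ α') (f : β ≃ β') (r : α' → β' → Prop),
    holds r → holds fun i j => r (e i) (f j)

namespace RelClass

variable (F G : RelClass)

/-- The number of relations in `F` between an `m`-element and an `n`-element set. -/
noncomputable def count (m n : ℕ) : ℕ := Nat.card {r : Fin m → Fin n → Prop // F.holds r}

theorem card_eq_of_equiv {α β α' β' : Type} (e : α ≃ α') (f : β ≃ β') :
    Nat.card {r : α → β → Prop // F.holds r} = Nat.card {r : α' → β' → Prop // F.holds r} := by
  refine Nat.card_congr ((Equiv.arrowCongr e (Equiv.arrowCongr f (Equiv.refl Prop))).subtypeEquiv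
    fun r => ⟨fun h => F.iso e.symm f.symm r h, fun h => ?_⟩)
  have := F.iso e f _ h
  simpa [Equiv.arrowCongr] using this

theorem card_eq_count {α β : Type} [Finite α] [Finite β] :
    Nat.card {r : α → β → Prop // F.holds r} = F.count (Nat.card α) (Nat.card β) :=
  F.card_eq_of_equiv (Finite.equivFin α) (Finite.equivFin β)

/-- `r` is the disjoint union of a relation in `F` between `p.1` and `p.2` and a relation in `G`
between the complements. -/
def IsSplit {α β : Type} (r : α → β → Prop) (p : Finset α × Finset β) : Prop :=
  (∀ i j, r i j → (i ∈ p.1 ↔ j ∈ p.2)) ∧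
    F.holds (fun (i : {i // i ∈ p.1}) (j : {j // j ∈ p.2}) => r i j) ∧
    G.holds (fun (i : {i // i ∉ p.1}) (j : {j // j ∉ p.2}) => r i j)

/-- A split relation is the pair of its two parts. -/
def splitEquiv {α β : Type} (p : Finset α × Finset β) :
    {r : α → β → Prop // IsSplit F G r p} ≃
      {r : {i // i ∈ p.1} → {j // j ∈ p.2} → Prop // F.holds r} ×
        {r : {i // i ∉ p.1} → {j // j ∉ p.2} → Prop // G.holds r} where
  toFun r := (⟨_, r.2.2.1⟩, ⟨_, r.2.2.2⟩)
  invFun q := ⟨fun i j => (∃ hi hj, q.1.1 ⟨i, hi⟩ ⟨j, hj⟩) ∨ ∃ hi hj, q.2.1 ⟨i, hi⟩ ⟨j, hj⟩, by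
    obtain ⟨⟨r₁, h₁⟩, ⟨r₂, h₂⟩⟩ := q
    refine ⟨?_, ?_, ?_⟩
    · rintro i j (⟨hi, hj, -⟩ | ⟨hi, hj, -⟩) <;> simp [hi, hj]
    · convert h₁ with i j
      simp [i.2]
    · convert h₂ with i j
      simp [i.2, j.2]⟩
  left_inv := by
    rintro ⟨r, h, -, -⟩
    ext i j
    have := h i j
    simp only [exists_prop]
    tauto
  right_inv := by
    rintro ⟨⟨r₁, h₁⟩, ⟨r₂, h₂⟩⟩
    ext i j
    · simp [i.2]
    · simp [i.2, j.2]

theorem card_isSplit_eq_sum (m n : ℕ) :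
    Nat.card {q : (Fin m → Fin n → Prop) × (Finset (Fin m) × Finset (Fin n)) //
      IsSplit F G q.1 q.2} =
    ∑ S : Finset (Fin m), ∑ T : Finset (Fin n),
      F.count S.card T.card * G.count (m - S.card) (n - T.card) := by
  have e : {q : (Fin m → Fin n → Prop) × (Finset (Fin m) × Finset (Fin n)) //
      IsSplit F G q.1 q.2} ≃ Σ p, {r : Fin m → Fin n → Prop // IsSplit F G r p} :=
    { toFun := fun q => ⟨q.1.2, ⟨q.1.1, q.2⟩⟩
      invFun := fun q => ⟨(q.2.1, q.1), q.2.2⟩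
      left_inv := fun q => rfl
      right_inv := fun q => rfl }
  rw [Nat.card_congr e, Nat.card_sigma, Fintype.sum_prod_type]
  refine Finset.sum_congr rfl fun S _ => Finset.sum_congr rfl fun T _ => ?_
  rw [Nat.card_congr (splitEquiv F G (S, T)), Nat.card_prod, card_eq_count, card_eq_count]
  simp [Nat.card_eq_fintype_card, Fintype.card_subtype_compl]

/-- The product principle. To use it one only has to count the splittings of each relation: one in
`card_subtype_prod_of_iff`, a constant number in `card_subtype_prod_of_card`. -/
theorem doubleEGF_count_mul :
    doubleEGF F.count * doubleEGF G.count = doubleEGF fun m n =>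
      Nat.card {q : (Fin m → Fin n → Prop) × (Finset (Fin m) × Finset (Fin n)) //
        IsSplit F G q.1 q.2} := by
  simp_rw [doubleEGF_mul, card_isSplit_eq_sum]

end RelClass

theorem card_subtype_prod_of_iff {A B : Type} {P : A → B → Prop} {H : A → Prop} (f : A → B)
    (h : ∀ a b, P a b ↔ H a ∧ b = f a) :
    Nat.card {q : A × B // P q.1 q.2} = Nat.card {a // H a} :=
  Nat.card_congr
    { toFun := fun q => ⟨q.1.1, ((h _ _).mp q.2).1⟩
      invFun := fun a => ⟨(a.1, f a.1), (h _ _).mpr ⟨a.2, rfl⟩⟩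
      left_inv := fun q => by
        ext
        · rfl
        · exact ((h _ _).mp q.2).2.symm
      right_inv := fun a => rfl }

theorem card_subtype_prod_of_card {A B : Type} [Finite A] [Finite B] {P : A → B → Prop}
    {H : A → Prop} (c : ℕ) (hPH : ∀ a b, P a b → H a)
    (h : ∀ a, H a → Nat.card {b // P a b} = c) :
    Nat.card {q : A × B // P q.1 q.2} = Nat.card {a // H a} * c := by
  have e : {q : A × B // P q.1 q.2} ≃ Σ a : {a // H a}, {b // P a.1 b} :=
    { toFun := fun q => ⟨⟨q.1.1, hPH _ _ q.2⟩, ⟨q.1.2, q.2⟩⟩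
      invFun := fun q => ⟨(q.1.1, q.2.1), q.2.2⟩
      left_inv := fun q => rfl
      right_inv := fun q => rfl }
  have := Fintype.ofFinite {a // H a}
  rw [Nat.card_congr e, Nat.card_sigma, Finset.sum_congr rfl fun a _ => h a.1 a.2]
  simp [Nat.card_eq_fintype_card]

/-! ### Nested relations and the kernel series -/

section Nested

variable {α β : Type}

/-- The rows of `r` are nested. -/
def Nested (r : α → β → Prop) : Prop :=
  ∀ i i' j j', r i j → r i' j' → r i j' ∨ r i' j

/-- No row of `r` is empty. -/
def RowFull (r : α → β → Prop) : Prop := ∀ i, ∃ j, r i j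

/-- No column of `r` is empty. -/
def ColFull (r : α → β → Prop) : Prop := ∀ j, ∃ i, r i j

theorem Nested.flip {r : α → β → Prop} (h : Nested r) : Nested (flip r) :=
  fun j j' i i' h₁ h₂ => (h i i' j j' h₁ h₂).symm

/-- Complementation turns the forbidden 2×2 pattern into the same pattern with its columns
exchanged. -/
theorem Nested.compl {r : α → β → Prop} (h : Nested r) : Nested fun i j => ¬ r i j := by
  intro i i' j j' h₁ h₂
  have := h i i' j' j
  tauto

theorem Nested.comap {α' β' : Type} {r : α → β → Prop} (h : Nested r) (e : α' → α) (f : β' → β) :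
    Nested fun i j => r (e i) (f j) :=
  fun i i' j j' => h (e i) (e i') (f j) (f j')

/-- A row of maximal size is full: a row meeting a column it misses would strictly contain it. -/
theorem Nested.exists_full_row [Finite α] [Finite β] [Nonempty α] {r : α → β → Prop}
    (h : Nested r) (hc : ColFull r) : ∃ i, ∀ j, r i j := by
  obtain ⟨i, hi⟩ := Finite.exists_max fun i => {j | r i j}.ncard
  refine ⟨i, fun j => ?_⟩
  by_contra hj
  obtain ⟨i', hi'⟩ := hc j
  refine (hi i').not_gt (Set.ncard_lt_ncard ?_)
  refine ⟨fun j' hj' => (h i i' j' j hj' hi').resolve_left hj, fun hs => hj (hs hi')⟩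

end Nested

/-- Nested relations with neither empty rows nor empty columns. -/
def pureNested : RelClass where
  holds r := Nested r ∧ RowFull r ∧ ColFull r
  iso e f _ h := ⟨h.1.comap e f,
    fun i => (h.2.1 (e i)).imp' f.symm (by simp), fun j => (h.2.2 (f j)).imp' e.symm (by simp)⟩

/-- Nonempty nested relations with neither empty rows nor empty columns. -/
def connNested : RelClass where
  holds {α _} r := Nonempty α ∧ pureNested.holds r
  iso e f _ h := ⟨h.1.map e.symm, pureNested.iso e f _ h.2⟩

/-- The empty relation. -/
def emptyRel : RelClass where
  holds r := ∀ i j, ¬ r i j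
  iso e f _ h i j := h (e i) (f j)

/-- Relations without rows. -/
def noRows : RelClass where
  holds {α _} _ := IsEmpty α
  iso e _ _ h := e.isEmpty_congr.mpr h

/-- Relations without columns. -/
def noCols : RelClass where
  holds {_ β} _ := IsEmpty β
  iso _ f _ h := f.isEmpty_congr.mpr h

theorem count_emptyRel : emptyRel.count = fun _ _ => 1 := by
  ext m n
  rw [RelClass.count, Nat.card_eq_one_iff_unique]
  refine ⟨⟨fun r s => ?_⟩, ⟨⟨fun _ _ => False, fun _ _ h => h⟩⟩⟩
  ext i j
  exact iff_of_false (r.2 i j) (s.2 i j)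

theorem count_noRows : noRows.count = fun m _ => if m = 0 then 1 else 0 := by
  ext m n
  rw [RelClass.count]
  rcases Nat.eq_zero_or_pos m with rfl | hm
  · rw [if_pos rfl, Nat.card_eq_one_iff_unique]
    exact ⟨⟨fun r s => Subsingleton.elim _ _⟩, ⟨⟨fun _ _ => False, Fin.isEmpty⟩⟩⟩
  · rw [if_neg hm.ne', Nat.card_eq_zero]
    exact Or.inl ⟨fun r => r.2.elim ⟨0, hm⟩⟩

theorem count_noCols : noCols.count = fun _ n => if n = 0 then 1 else 0 := by
  ext m n
  rw [RelClass.count]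
  rcases Nat.eq_zero_or_pos n with rfl | hn
  · rw [if_pos rfl, Nat.card_eq_one_iff_unique]
    exact ⟨⟨fun r s => Subsingleton.elim _ _⟩, ⟨⟨fun _ _ => False, Fin.isEmpty⟩⟩⟩
  · rw [if_neg hn.ne', Nat.card_eq_zero]
    exact Or.inl ⟨fun r => r.2.elim ⟨0, hn⟩⟩

section Splits

open Classical in
/-- The nonempty rows and the nonempty columns of a relation. -/
noncomputable def relSupport {α β : Type} [Fintype α] [Fintype β] (r : α → β → Prop) :
    Finset α × Finset β :=
  (Finset.univ.filter fun i => ∃ j, r i j, Finset.univ.filter fun j => ∃ i, r i j)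

variable {α β : Type} [Fintype α] [Fintype β] (r : α → β → Prop) (p : Finset α × Finset β)

/-- The splitting is forced: the first part has no empty rows or columns and the rest has no related
pairs, so the first part is the support. -/
theorem isSplit_pureNested_emptyRel :
    RelClass.IsSplit pureNested emptyRel r p ↔ Nested r ∧ p = relSupport r := by
  obtain ⟨S, T⟩ := p
  constructor
  · rintro ⟨h, ⟨hn, hr, hc⟩, h0⟩
    have h1 : ∀ i j, r i j → i ∈ S ∧ j ∈ T := by
      intro i j hij
      have h2 := h i j hij
      by_cases hi : i ∈ S
      · exact ⟨hi, h2.mp hi⟩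
      · exact (h0 ⟨i, hi⟩ ⟨j, h2.not.mp hi⟩ hij).elim
    refine ⟨?_, Prod.ext ?_ ?_⟩
    · intro i i' j j' hij hij'
      exact hn ⟨i, (h1 _ _ hij).1⟩ ⟨i', (h1 _ _ hij').1⟩ ⟨j, (h1 _ _ hij).2⟩
        ⟨j', (h1 _ _ hij').2⟩ hij hij'
    · ext i
      simp only [relSupport, Finset.mem_filter_univ]
      exact ⟨fun hi => (hr ⟨i, hi⟩).imp' Subtype.val fun _ h => h,
        fun ⟨j, hj⟩ => (h1 _ _ hj).1⟩
    · ext j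
      simp only [relSupport, Finset.mem_filter_univ]
      exact ⟨fun hj => (hc ⟨j, hj⟩).imp' Subtype.val fun _ h => h,
        fun ⟨i, hi⟩ => (h1 _ _ hi).2⟩
  · rintro ⟨hn, h⟩
    obtain ⟨rfl, rfl⟩ := Prod.ext_iff.mp h
    refine ⟨fun i j hij => ?_, ⟨hn.comap _ _, ?_, ?_⟩, ?_⟩
    · exact iff_of_true (by simpa [relSupport] using ⟨j, hij⟩)
        (by simpa [relSupport] using ⟨i, hij⟩)
    · rintro ⟨i, hi⟩
      obtain ⟨j, hj⟩ : ∃ j, r i j := by simpa [relSupport] using hi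
      exact ⟨⟨j, by simpa [relSupport] using ⟨i, hj⟩⟩, hj⟩
    · rintro ⟨j, hj⟩
      obtain ⟨i, hi⟩ : ∃ i, r i j := by simpa [relSupport] using hj
      exact ⟨⟨i, by simpa [relSupport] using ⟨j, hi⟩⟩, hi⟩
    · rintro ⟨i, hi⟩ j hij
      exact hi (by simpa [relSupport] using ⟨j.1, hij⟩)

theorem isSplit_pureNested_noRows :
    RelClass.IsSplit pureNested noRows r p ↔ (Nested r ∧ RowFull r) ∧ p = relSupport r := by
  have h1 : RelClass.IsSplit pureNested noRows r p ↔
      RelClass.IsSplit pureNested emptyRel r p ∧ IsEmpty {i // i ∉ p.1} :=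
    ⟨fun h => ⟨⟨h.1, h.2.1, fun i => h.2.2.elim i⟩, h.2.2⟩, fun h => ⟨h.1.1, h.1.2.1, h.2⟩⟩
  rw [h1, isSplit_pureNested_emptyRel, and_right_comm]
  refine and_congr_left ?_
  rintro rfl
  simp [relSupport, RowFull, isEmpty_subtype]

theorem isSplit_pureNested_noCols :
    RelClass.IsSplit pureNested noCols r p ↔ (Nested r ∧ ColFull r) ∧ p = relSupport r := by
  have h1 : RelClass.IsSplit pureNested noCols r p ↔
      RelClass.IsSplit pureNested emptyRel r p ∧ IsEmpty {j // j ∉ p.2} :=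
    ⟨fun h => ⟨⟨h.1, h.2.1, fun _ j => h.2.2.elim j⟩, h.2.2⟩, fun h => ⟨h.1.1, h.1.2.1, h.2⟩⟩
  rw [h1, isSplit_pureNested_emptyRel, and_right_comm]
  refine and_congr_left ?_
  rintro rfl
  simp [relSupport, ColFull, isEmpty_subtype]

end Splits

/-- The bijection is complementation: a nested relation without empty rows or columns has a full row
and a full column, which become empty. In size 0×0 this fails, since both fullness conditions hold
vacuously. -/
theorem card_pureNested_eq_card_not_full {m n : ℕ} (h : ¬ (m = 0 ∧ n = 0)) :
    {r : Fin m → Fin n → Prop | pureNested.holds r}.ncard =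
      {r : Fin m → Fin n → Prop | Nested r ∧ ¬ RowFull r ∧ ¬ ColFull r}.ncard := by
  have hinj : Function.Injective fun (r : Fin m → Fin n → Prop) i j => ¬ r i j := by
    intro r s hrs
    ext i j
    exact not_iff_not.mp (iff_of_eq (congrFun (congrFun hrs i) j))
  rw [← Set.ncard_image_of_injective _ hinj]
  congr 1
  ext r
  simp only [Set.mem_image, Set.mem_ofPred_eq]
  constructor
  · rintro ⟨s, ⟨hn, hr, hc⟩, rfl⟩
    have hm : Nonempty (Fin m) := by
      by_contra h'
      have hm : m = 0 := by
        simpa [← Fin.pos_iff_nonempty] using h'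
      have hn' : 0 < n := by omega
      exact h' (hc ⟨0, hn'⟩).nonempty
    have hn' : Nonempty (Fin n) := (hr hm.some).nonempty
    obtain ⟨i, hi⟩ := hn.exists_full_row hc
    obtain ⟨j, hj⟩ := hn.flip.exists_full_row hr
    exact ⟨hn.compl, fun h => (h i).elim fun j hj => hj (hi j),
      fun h => (h j).elim fun i hi => hi (hj i)⟩
  · rintro ⟨hn, hr, hc⟩
    simp only [RowFull, ColFull, not_forall, not_exists] at hr hc
    obtain ⟨i, hi⟩ := hr
    obtain ⟨j, hj⟩ := hc
    exact ⟨fun i j => ¬ r i j, ⟨hn.compl, fun i' => ⟨j, hj i'⟩, fun j' => ⟨i, hi j'⟩⟩, by simp⟩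

/-- Inclusion–exclusion: the intersection of the two sets on the left is as large as the complement
of their union, up to the 0×0 correction. -/
theorem card_colFull_add_card_rowFull (m n : ℕ) :
    Nat.card {r : Fin m → Fin n → Prop // Nested r ∧ ColFull r} +
      Nat.card {r : Fin m → Fin n → Prop // Nested r ∧ RowFull r} =
    Nat.card {r : Fin m → Fin n → Prop // Nested r} + if m = 0 ∧ n = 0 then 1 else 0 := by
  let N : Set (Fin m → Fin n → Prop) := {r | Nested r}
  let A : Set (Fin m → Fin n → Prop) := {r | Nested r ∧ ColFull r}
  let B : Set (Fin m → Fin n → Prop) := {r | Nested r ∧ RowFull r}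
  let Z : Set (Fin m → Fin n → Prop) := {r | Nested r ∧ ¬ RowFull r ∧ ¬ ColFull r}
  change A.ncard + B.ncard = N.ncard + _
  have h1 := Set.ncard_union_add_ncard_inter A B
  have h2 : N.ncard = (A ∪ B).ncard + Z.ncard := by
    rw [← Set.ncard_union_eq]
    · congr 1
      ext r
      simp only [N, A, B, Z, Set.mem_union, Set.mem_ofPred_eq]
      by_cases hr : RowFull r <;> by_cases hc : ColFull r <;> simp [hr, hc]
    · rw [Set.disjoint_left]
      simp only [A, B, Z, Set.mem_union, Set.mem_ofPred_eq]
      tauto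
  have h3 : (A ∩ B).ncard = Z.ncard + if m = 0 ∧ n = 0 then 1 else 0 := by
    have h4 : A ∩ B = {r : Fin m → Fin n → Prop | pureNested.holds r} := by
      ext r
      simp only [A, B, pureNested, Set.mem_inter_iff, Set.mem_ofPred_eq]
      tauto
    by_cases h : m = 0 ∧ n = 0
    · obtain ⟨rfl, rfl⟩ := h
      have h5 : Z = ∅ := by
        ext r
        simp [Z, RowFull]
      have h6 : A ∩ B = {fun _ _ => False} := by
        rw [h4]
        ext r
        simp only [Set.mem_ofPred_eq, Set.mem_singleton_iff]
        exact iff_of_true ⟨fun i => i.elim0, fun i => i.elim0, fun i => i.elim0⟩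
          (Subsingleton.elim _ _)
      simp [h5, h6]
    · rw [if_neg h, h4, card_pureNested_eq_card_not_full h, add_zero]
  omega

theorem doubleEGF_pureNested_mul :
    doubleEGF pureNested.count * (expOf x + expOf y - expOf (x + y)) = 1 := by
  rw [mul_sub, mul_add, expOf_x, expOf_y, expOf_x_add_y, ← count_noCols, ← count_noRows,
    ← count_emptyRel, RelClass.doubleEGF_count_mul, RelClass.doubleEGF_count_mul,
    RelClass.doubleEGF_count_mul, sub_eq_iff_eq_add', ← doubleEGF_zero_zero,
    doubleEGF_add, doubleEGF_add]
  congr 1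
  ext m n
  rw [card_subtype_prod_of_iff _ isSplit_pureNested_noCols,
    card_subtype_prod_of_iff _ isSplit_pureNested_noRows,
    card_subtype_prod_of_iff _ isSplit_pureNested_emptyRel]
  exact card_colFull_add_card_rowFull m n

theorem constantCoeff_expOf {f : MvPowerSeries (Fin 2) ℚ}
    (hf : MvPowerSeries.constantCoeff f = 0) : MvPowerSeries.constantCoeff (expOf f) = 1 := by
  rw [← MvPowerSeries.coeff_zero_eq_constantCoeff_apply, coeff_expOf hf 0 1]
  · simp
  · intro k hk
    rw [MvPowerSeries.coeff_zero_eq_constantCoeff_apply, map_pow, hf, zero_pow (by omega)]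

theorem constantCoeff_kernelSeries_denom :
    MvPowerSeries.constantCoeff (expOf x + expOf y - expOf (x + y)) = 1 := by
  rw [map_sub, map_add, constantCoeff_expOf (by simp [x]), constantCoeff_expOf (by simp [y]),
    constantCoeff_expOf (by simp [x, y])]
  norm_num

theorem kernelSeries_eq : kernelSeries = doubleEGF pureNested.count := by
  symm
  rw [kernelSeries, MvPowerSeries.eq_inv_iff_mul_eq_one, doubleEGF_pureNested_mul]
  rw [constantCoeff_kernelSeries_denom]
  exact one_ne_zero

theorem constantCoeff_kernelSeries : MvPowerSeries.constantCoeff kernelSeries = 1 := by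
  rw [kernelSeries, MvPowerSeries.constantCoeff_inv, constantCoeff_kernelSeries_denom, inv_one]

theorem doubleEGF_connNested : doubleEGF connNested.count = kernelSeries - 1 := by
  rw [eq_sub_iff_add_eq, kernelSeries_eq, ← doubleEGF_zero_zero, doubleEGF_add]
  congr 1
  ext m n
  rw [RelClass.count, RelClass.count]
  by_cases h : m = 0 ∧ n = 0
  · obtain ⟨rfl, rfl⟩ := h
    rw [if_pos ⟨rfl, rfl⟩, Nat.card_eq_zero.mpr (Or.inl ⟨fun r => r.2.1.elim fun i => i.elim0⟩),
      zero_add, eq_comm, Nat.card_eq_one_iff_unique]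
    exact ⟨⟨fun r s => Subsingleton.elim _ _⟩,
      ⟨⟨fun _ _ => False, fun i => i.elim0, fun i => i.elim0, fun i => i.elim0⟩⟩⟩
  · rw [if_neg h, add_zero]
    refine Nat.card_congr (Equiv.subtypeEquivRight fun r => ⟨fun h => h.2, fun hr => ⟨?_, hr⟩⟩)
    rcases Nat.eq_zero_or_pos m with hm | hm
    · have hn : 0 < n := by omega
      exact (hr.2.2 ⟨0, hn⟩).nonempty
    · exact ⟨⟨0, hm⟩⟩

end Lonesum

/-! ### Blocks of a relation -/

namespace Lonesum

section Blocks

variable {α β α' β' : Type}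

/-- `p` consists of the rows and columns of a nonempty nested component of `r`. -/
structure IsBlock (r : α → β → Prop) (p : Finset α × Finset β) : Prop where
  closed : ∀ i j, r i j → (i ∈ p.1 ↔ j ∈ p.2)
  nonempty : p.1.Nonempty
  row : ∀ i ∈ p.1, ∃ j, r i j
  col : ∀ j ∈ p.2, ∃ i, r i j
  nested : ∀ i ∈ p.1, ∀ i' ∈ p.1, ∀ j j', r i j → r i' j' → r i j' ∨ r i' j

/-- Every pair of related elements lies in a block. -/
def Covered (r : α → β → Prop) : Prop := ∀ i j, r i j → ∃ p, IsBlock r p ∧ i ∈ p.1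

theorem isBlock_iff {r : α → β → Prop} {p : Finset α × Finset β} :
    IsBlock r p ↔ (∀ i j, r i j → (i ∈ p.1 ↔ j ∈ p.2)) ∧
      connNested.holds (fun (i : {i // i ∈ p.1}) (j : {j // j ∈ p.2}) => r i j) := by
  constructor
  · intro h
    refine ⟨h.closed, h.nonempty.to_subtype, ?_, ?_, ?_⟩
    · exact fun i i' j j' => h.nested i i.2 i' i'.2 j j'
    · rintro ⟨i, hi⟩
      obtain ⟨j, hj⟩ := h.row i hi
      exact ⟨⟨j, (h.closed i j hj).mp hi⟩, hj⟩
    · rintro ⟨j, hj⟩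
      obtain ⟨i, hi⟩ := h.col j hj
      exact ⟨⟨i, (h.closed i j hi).mpr hj⟩, hi⟩
  · rintro ⟨hcl, hne, hn, hr, hc⟩
    refine ⟨hcl, Finset.nonempty_coe_sort.mp hne, ?_, ?_, ?_⟩
    · exact fun i hi => (hr ⟨i, hi⟩).imp' Subtype.val fun _ h => h
    · exact fun j hj => (hc ⟨j, hj⟩).imp' Subtype.val fun _ h => h
    · intro i hi i' hi' j j' h h'
      exact hn ⟨i, hi⟩ ⟨i', hi'⟩ ⟨j, (hcl i j h).mp hi⟩ ⟨j', (hcl i' j' h').mp hi'⟩ h h'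

namespace IsBlock

variable {r : α → β → Prop} {p q : Finset α × Finset β}

/-- Any two rows of a block share a column by nestedness, so a set closed under the relation that
contains one row of the block contains them all. -/
theorem fst_subset (hp : IsBlock r p) (hq : IsBlock r q) {i : α} (hip : i ∈ p.1)
    (hiq : i ∈ q.1) : p.1 ⊆ q.1 := by
  obtain ⟨j, hj⟩ := hp.row i hip
  have hjq := (hq.closed i j hj).mp hiq
  intro i' hi'
  obtain ⟨j', hj'⟩ := hp.row i' hi'
  rcases hp.nested i hip i' hi' j j' hj hj' with h | h
  · exact (hq.closed i' j' hj').mpr ((hq.closed i j' h).mp hiq)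
  · exact (hq.closed i' j h).mpr hjq

theorem snd_subset (hp : IsBlock r p) (hq : IsBlock r q) (h : p.1 ⊆ q.1) : p.2 ⊆ q.2 := by
  intro j hj
  obtain ⟨i, hi⟩ := hp.col j hj
  exact (hq.closed i j hi).mp (h ((hp.closed i j hi).mpr hj))

theorem eq_of_mem (hp : IsBlock r p) (hq : IsBlock r q) {i : α} (hip : i ∈ p.1)
    (hiq : i ∈ q.1) : p = q := by
  have h1 := hp.fst_subset hq hip hiq
  have h2 := hq.fst_subset hp hiq hip
  exact Prod.ext (h1.antisymm h2) ((hp.snd_subset hq h1).antisymm (hq.snd_subset hp h2))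

theorem snd_nonempty (hp : IsBlock r p) : p.2.Nonempty := by
  obtain ⟨i, hi⟩ := hp.nonempty
  obtain ⟨j, hj⟩ := hp.row i hi
  exact ⟨j, (hp.closed i j hj).mp hi⟩

end IsBlock

variable (φ : α' ↪ α) (ψ : β' ↪ β) {r : α → β → Prop}

/-- The image of a pair of finsets under a pair of embeddings. -/
def mapPair (p : Finset α' × Finset β') : Finset α × Finset β := (p.1.map φ, p.2.map ψ)

theorem mapPair_injective : Function.Injective (mapPair φ ψ) := by
  rintro ⟨S, T⟩ ⟨S', T'⟩ h
  simpa [mapPair] using h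

variable (hr : ∀ i j, r i j → (i ∈ Set.range φ ↔ j ∈ Set.range ψ))

include hr in
-- Since `hr` makes the ranges closed under r, being a block inside them does not depend on what
-- lies outside.
theorem isBlock_mapPair (p : Finset α' × Finset β') :
    IsBlock r (mapPair φ ψ p) ↔ IsBlock (fun i j => r (φ i) (ψ j)) p := by
  constructor
  · rintro ⟨hcl, hne, hrow, hcol, hn⟩
    simp only [mapPair, Finset.mem_map, forall_exists_index, and_imp,
      forall_apply_eq_imp_iff₂, Finset.map_nonempty] at *
    refine ⟨fun i j h => by simpa using hcl _ _ h, hne, fun i hi => ?_, fun j hj => ?_,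
      fun i hi i' hi' j j' => hn i hi i' hi' _ _⟩
    · obtain ⟨j, hj⟩ := hrow i hi
      obtain ⟨j, rfl⟩ := (hr _ _ hj).mp ⟨i, rfl⟩
      exact ⟨j, hj⟩
    · obtain ⟨i, hi⟩ := hcol j hj
      obtain ⟨i, rfl⟩ := (hr _ _ hi).mpr ⟨j, rfl⟩
      exact ⟨i, hi⟩
  · rintro ⟨hcl, hne, hrow, hcol, hn⟩
    refine ⟨?_, by simpa [mapPair] using hne, ?_, ?_, ?_⟩
    · intro i j hij
      simp only [mapPair, Finset.mem_map]
      constructor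
      · rintro ⟨i, hi, rfl⟩
        obtain ⟨j, rfl⟩ := (hr _ _ hij).mp ⟨i, rfl⟩
        exact ⟨j, (hcl _ _ hij).mp hi, rfl⟩
      · rintro ⟨j, hj, rfl⟩
        obtain ⟨i, rfl⟩ := (hr _ _ hij).mpr ⟨j, rfl⟩
        exact ⟨i, (hcl _ _ hij).mpr hj, rfl⟩
    · simp only [mapPair, Finset.mem_map]
      rintro _ ⟨i, hi, rfl⟩
      exact (hrow i hi).imp' ψ fun _ h => h
    · simp only [mapPair, Finset.mem_map]
      rintro _ ⟨j, hj, rfl⟩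
      exact (hcol j hj).imp' φ fun _ h => h
    · simp only [mapPair, Finset.mem_map]
      rintro _ ⟨i, hi, rfl⟩ _ ⟨i', hi', rfl⟩ j j' h h'
      obtain ⟨j, rfl⟩ := (hr _ _ h).mp ⟨i, rfl⟩
      obtain ⟨j', rfl⟩ := (hr _ _ h').mp ⟨i', rfl⟩
      exact hn i hi i' hi' j j' h h'

include hr in
theorem IsBlock.exists_mapPair {q : Finset α × Finset β} (hq : IsBlock r q)
    (h : ∀ i ∈ q.1, i ∈ Set.range φ) :
    ∃ p, IsBlock (fun i j => r (φ i) (ψ j)) p ∧ mapPair φ ψ p = q := by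
  have h' : ∀ j ∈ q.2, j ∈ Set.range ψ := by
    intro j hj
    obtain ⟨i, hi⟩ := hq.col j hj
    exact (hr i j hi).mp (h i ((hq.closed i j hi).mpr hj))
  have e : mapPair φ ψ (q.1.preimage φ φ.injective.injOn, q.2.preimage ψ ψ.injective.injOn)
      = q := by
    ext i
    · simp only [mapPair, Finset.mem_map, Finset.mem_preimage]
      constructor
      · rintro ⟨i, hi, rfl⟩
        exact hi
      · intro hi
        obtain ⟨i, rfl⟩ := h i hi
        exact ⟨i, hi, rfl⟩
    · simp only [mapPair, Finset.mem_map, Finset.mem_preimage]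
      constructor
      · rintro ⟨i, hi, rfl⟩
        exact hi
      · intro hi
        obtain ⟨i, rfl⟩ := h' i hi
        exact ⟨i, hi, rfl⟩
  exact ⟨_, (isBlock_mapPair φ ψ hr _).mp (e.symm ▸ hq), e⟩

include hr in
theorem image_mapPair_setOf_isBlock :
    mapPair φ ψ '' {p | IsBlock (fun i j => r (φ i) (ψ j)) p} =
      {q | IsBlock r q ∧ ∀ i ∈ q.1, i ∈ Set.range φ} := by
  ext q
  constructor
  · rintro ⟨p, hp, rfl⟩
    refine ⟨(isBlock_mapPair φ ψ hr p).mpr hp, fun i hi => ?_⟩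
    obtain ⟨i, -, rfl⟩ := Finset.mem_map.mp hi
    exact ⟨i, rfl⟩
  · rintro ⟨hq, h⟩
    exact hq.exists_mapPair φ ψ hr h

include hr in
theorem covered_comap_iff :
    Covered (fun i j => r (φ i) (ψ j)) ↔
      ∀ i j, r (φ i) j → ∃ q, IsBlock r q ∧ (∀ i ∈ q.1, i ∈ Set.range φ) ∧ φ i ∈ q.1 := by
  constructor
  · intro h i j hij
    obtain ⟨j, rfl⟩ := (hr _ _ hij).mp ⟨i, rfl⟩
    obtain ⟨p, hp, hi⟩ := h i j hij
    have := (image_mapPair_setOf_isBlock φ ψ hr).subset ⟨p, hp, rfl⟩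
    exact ⟨_, this.1, this.2, Finset.mem_map_of_mem φ hi⟩
  · intro h i j hij
    obtain ⟨q, hq, hr', hi⟩ := h i _ hij
    obtain ⟨p, hp, rfl⟩ := hq.exists_mapPair φ ψ hr hr'
    exact ⟨p, hp, by simpa [mapPair] using hi⟩

end Blocks

/-- Relations that decompose into `k` nested blocks. -/
def blockClass (k : ℕ) : RelClass where
  holds r := Covered r ∧ {p | IsBlock r p}.ncard = k
  iso e f r h := by
    have hr : ∀ i j, r i j →
        (i ∈ Set.range e.toEmbedding ↔ j ∈ Set.range f.toEmbedding) := by simp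
    refine ⟨(covered_comap_iff e.toEmbedding f.toEmbedding hr).mpr fun i j hij => ?_, ?_⟩
    · obtain ⟨q, hq, hi⟩ := h.1 _ _ hij
      exact ⟨q, hq, by simp, hi⟩
    · rw [← h.2, ← Set.ncard_image_of_injective _
        (mapPair_injective e.toEmbedding f.toEmbedding)]
      congr 1
      rw [show (fun i j => r (e i) (f j)) =
        fun i j => r (e.toEmbedding i) (f.toEmbedding j) from rfl,
        image_mapPair_setOf_isBlock _ _ hr]
      simp

section

variable {α β : Type} [Finite α] [Finite β] {r : α → β → Prop}

/-- Distinct blocks are disjoint, so the blocks of the complement of p are exactly the blocks of r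
other than p. -/
theorem isSplit_connNested_blockClass (k : ℕ) (p : Finset α × Finset β) :
    RelClass.IsSplit connNested (blockClass k) r p ↔
      (blockClass (k + 1)).holds r ∧ IsBlock r p := by
  rw [RelClass.IsSplit, ← and_assoc, ← isBlock_iff, and_comm]
  refine and_congr_left fun hp => ?_
  let φ : {i // i ∉ p.1} ↪ α := Function.Embedding.subtype _
  let ψ : {j // j ∉ p.2} ↪ β := Function.Embedding.subtype _
  have hφ : ∀ i, i ∈ Set.range φ ↔ i ∉ p.1 := by simp [φ]
  have hψ : ∀ j, j ∈ Set.range ψ ↔ j ∉ p.2 := by simp [ψ]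
  have hr : ∀ i j, r i j → (i ∈ Set.range φ ↔ j ∈ Set.range ψ) := by
    intro i j hij
    rw [hφ, hψ, hp.closed i j hij]
  have hblock : ∀ q, IsBlock r q ∧ (∀ i ∈ q.1, i ∈ Set.range φ) ↔ IsBlock r q ∧ q ≠ p := by
    intro q
    refine and_congr_right fun hq => ⟨?_, ?_⟩
    · rintro h rfl
      obtain ⟨i, hi⟩ := hq.nonempty
      exact (hφ i).mp (h i hi) hi
    · intro h i hi
      exact (hφ i).mpr fun hi' => h (hq.eq_of_mem hp hi hi')
  refine and_congr ((covered_comap_iff φ ψ hr).trans ⟨fun h i j hij => ?_, fun h i j hij => ?_⟩) ?_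
  · by_cases hi : i ∈ p.1
    · exact ⟨p, hp, hi⟩
    · obtain ⟨q, hq, -, hiq⟩ := h ⟨i, hi⟩ j hij
      exact ⟨q, hq, hiq⟩
  · obtain ⟨q, hq, hiq⟩ := h _ _ hij
    refine ⟨q, hq, ((hblock q).mpr ⟨hq, ?_⟩).2, hiq⟩
    rintro rfl
    exact i.2 hiq
  · have h1 : {q | IsBlock r q} =
        insert p (mapPair φ ψ '' {p | IsBlock (fun i j => r (φ i) (ψ j)) p}) := by
      rw [image_mapPair_setOf_isBlock φ ψ hr]
      ext q
      simp only [Set.mem_insert_iff, Set.mem_ofPred_eq]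
      rw [hblock q]
      by_cases h : q = p
      · simp [h, hp]
      · simp [h]
    have h2 : p ∉ mapPair φ ψ '' {p | IsBlock (fun i j => r (φ i) (ψ j)) p} := by
      rw [image_mapPair_setOf_isBlock φ ψ hr]
      exact fun h => ((hblock p).mp h).2 rfl
    rw [h1, Set.ncard_insert_of_notMem h2, Set.ncard_image_of_injective _ (mapPair_injective φ ψ),
      add_left_inj]
    exact Iff.rfl

theorem blockClass_zero : (blockClass 0).holds r ↔ emptyRel.holds r := by
  constructor
  · rintro ⟨h, h0⟩ i j hij
    obtain ⟨p, hp, -⟩ := h i j hij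
    rw [Set.ncard_eq_zero] at h0
    exact Set.notMem_empty p (h0 ▸ hp)
  · intro h
    refine ⟨fun i j hij => (h i j hij).elim, ?_⟩
    rw [Set.ncard_eq_zero, Set.eq_empty_iff_forall_notMem]
    intro p hp
    obtain ⟨i, hi⟩ := hp.nonempty
    obtain ⟨j, hj⟩ := hp.row i hi
    exact h i j hj

end

/-- Induction on k: a relation with k+1 blocks splits off one block in k+1 ways, which produces the
factor 1/k!. -/
theorem doubleEGF_blockClass (k : ℕ) :
    doubleEGF (blockClass k).count =
      MvPowerSeries.C (1 / (k.factorial : ℚ)) * expOf (x + y) * (kernelSeries - 1) ^ k := by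
  induction k with
  | zero =>
    have h : (blockClass 0).count = emptyRel.count := by
      ext m n
      exact Nat.card_congr (Equiv.subtypeEquivRight fun r => blockClass_zero)
    rw [h, count_emptyRel, ← expOf_x_add_y]
    simp
  | succ k ih =>
    have h := RelClass.doubleEGF_count_mul connNested (blockClass k)
    have h1 : (doubleEGF fun m n =>
        Nat.card {q : (Fin m → Fin n → Prop) × (Finset (Fin m) × Finset (Fin n)) //
          RelClass.IsSplit connNested (blockClass k) q.1 q.2}) =
        MvPowerSeries.C ((k : ℚ) + 1) * doubleEGF (blockClass (k + 1)).count := by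
      ext d
      rw [MvPowerSeries.coeff_C_mul, coeff_doubleEGF, coeff_doubleEGF,
        card_subtype_prod_of_card (H := (blockClass (k + 1)).holds) (k + 1)]
      · rw [RelClass.count]
        push_cast
        ring
      · exact fun r p h => ((isSplit_connNested_blockClass k p).mp h).1
      · intro r hr
        rw [Nat.card_congr (Equiv.subtypeEquivRight fun p =>
          (isSplit_connNested_blockClass k p).trans (and_iff_right hr))]
        exact hr.2
    rw [h1, doubleEGF_connNested, ih] at h
    have h2 : MvPowerSeries.C (1 / ((k + 1).factorial : ℚ)) =
        MvPowerSeries.C (σ := Fin 2) (1 / ((k : ℚ) + 1)) *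
          MvPowerSeries.C (1 / (k.factorial : ℚ)) := by
      rw [← map_mul, Nat.factorial_succ]
      congr 1
      push_cast
      rw [one_div_mul_one_div]
    have h3 : MvPowerSeries.C (σ := Fin 2) (1 / ((k : ℚ) + 1)) * MvPowerSeries.C ((k : ℚ) + 1) =
        1 := by
      rw [← map_mul, one_div_mul_cancel (by positivity), map_one]
    calc doubleEGF (blockClass (k + 1)).count
        = MvPowerSeries.C (1 / ((k : ℚ) + 1)) *
            (MvPowerSeries.C ((k : ℚ) + 1) * doubleEGF (blockClass (k + 1)).count) := by
          rw [← mul_assoc, h3, one_mul]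
      _ = _ := by
          rw [← h, h2]
          ring

end Lonesum

/-! ### Lonesum matrices are the nested ones -/

namespace Lonesum

section Lonesum

variable {α β : Type}

/-- The relation of having a nonzero entry. -/
def rel (A : BinMatrix α β) (i : α) (j : β) : Prop := A i j ≠ 0

/-- Binary matrices are relations. -/
noncomputable def relEquiv : BinMatrix α β ≃ (α → β → Prop) where
  toFun := rel
  invFun r := open Classical in Matrix.of fun i j => if r i j then 1 else 0
  left_inv A := by
    ext i j
    have h : A i j = 0 ∨ A i j = 1 := by omega
    rcases h with h | h <;> simp [rel, h]
  right_inv r := by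
    ext i j
    simp [rel]

variable [Fintype α] [Fintype β] {A : BinMatrix α β}

theorem IsLonesum.nested (h : IsLonesum A) : Nested (rel A) := by
  classical
  intro i i' j j' h1 h2
  by_contra! h3
  have hij : A i j = 1 := by have := h1; simp only [rel] at this; omega
  have hij' : A i' j' = 1 := by have := h2; simp only [rel] at this; omega
  have h4 : A i j' = 0 := by simpa [rel] using h3.1
  have h5 : A i' j = 0 := by simpa [rel] using h3.2
  -- Switching the 2×2 permutation submatrix. B exchanges two rows within the columns j, j', which
  -- preserves column sums; `hrow` describes it as exchanging two columns within the rows i, i',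
  -- which preserves row sums.
  let B : BinMatrix α β :=
    Matrix.of fun a b => if b = j ∨ b = j' then A (Equiv.swap i i' a) b else A a b
  have hrow : ∀ a b, B a b = if a = i ∨ a = i' then A a (Equiv.swap j j' b) else A a b := by
    intro a b
    simp only [B, Matrix.of_apply]
    by_cases ha : a = i
    · subst ha
      by_cases hb : b = j
      · subst hb
        simp [h4, h5]
      · by_cases hb' : b = j'
        · subst hb'
          simp [hij, hij']
        · simp [hb, hb', Equiv.swap_apply_of_ne_of_ne]
    · by_cases ha' : a = i'
      · subst ha'
        by_cases hb : b = j
        · subst hb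
          simp [hij, hij']
        · by_cases hb' : b = j'
          · subst hb'
            simp [h4, h5]
          · simp [hb, hb', Equiv.swap_apply_of_ne_of_ne]
      · simp [ha, ha', Equiv.swap_apply_of_ne_of_ne]
  have hB : B = A := by
    apply h
    · intro a
      simp_rw [hrow]
      by_cases ha : a = i ∨ a = i'
      · simp only [ha, if_true]
        exact Equiv.sum_comp (Equiv.swap j j') fun b => (A a b : ℕ)
      · simp only [ha, if_false]
    · intro b
      simp only [B, Matrix.of_apply]
      by_cases hb : b = j ∨ b = j'
      · simp only [hb, if_true]
        exact Equiv.sum_comp (Equiv.swap i i') fun a => (A a b : ℕ)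
      · simp only [hb, if_false]
  have h6 := congrFun (congrFun hB i) j
  simp [B, h5, hij] at h6

/-- A weight of the form (row term) - (column term) has a total over the ones that depends only on
the margins. If it is positive on the ones of A and negative on its zeros, A is the unique maximizer
among matrices with its margins. -/
theorem Nested.isLonesum (h : Nested (rel A)) : IsLonesum A := by
  classical
  intro B hr hc
  let s : α → ℕ := fun i => {j | rel A i j}.ncard
  -- Threshold: A has a one at (i, j) exactly when t j ≤ s i. A column without zeros gets t j = 0,
  -- the empty supremum.
  let t : β → ℕ := fun j => (Finset.univ.filter fun i => A i j = 0).sup fun i => s i + 1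
  have h0 : ∀ i j, A i j = 0 → s i + 1 ≤ t j := fun i j hij =>
    Finset.le_sup (f := fun i => s i + 1) (by simpa using hij)
  have h1 : ∀ i j, A i j ≠ 0 → t j ≤ s i := by
    intro i j hij
    refine Finset.sup_le fun i' hi' => ?_
    have hi' : A i' j = 0 := by simpa using hi'
    refine Set.ncard_lt_ncard ⟨fun j' hj' => ?_, fun hs => hs hij hi'⟩
    exact (h i' i j' j hj' hij).resolve_left fun h => h hi'
  -- Doubling and adding 1 makes the weight odd, so it never vanishes, even when s i = t j.
  let w : α → β → ℤ := fun i j => 2 * s i + 1 - 2 * t j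
  have hr' : ∀ i, ∑ j, ((B i j : ℕ) : ℤ) = ∑ j, ((A i j : ℕ) : ℤ) := fun i => by
    exact_mod_cast hr i
  have hc' : ∀ j, ∑ i, ((B i j : ℕ) : ℤ) = ∑ i, ((A i j : ℕ) : ℤ) := fun j => by
    exact_mod_cast hc j
  have key : ∀ M : BinMatrix α β, ∑ i, ∑ j, ((M i j : ℕ) : ℤ) * w i j =
      ∑ i, (∑ j, ((M i j : ℕ) : ℤ)) * (2 * s i + 1) -
        ∑ j, (∑ i, ((M i j : ℕ) : ℤ)) * (2 * t j) := by
    intro M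
    simp_rw [Finset.sum_mul]
    rw [Finset.sum_comm (s := Finset.univ (α := β)), ← Finset.sum_sub_distrib]
    simp_rw [← Finset.sum_sub_distrib]
    exact Finset.sum_congr rfl fun i _ => Finset.sum_congr rfl fun j _ => by ring
  have hsum : ∑ i, ∑ j, (((A i j : ℕ) : ℤ) - ((B i j : ℕ) : ℤ)) * w i j = 0 := by
    simp_rw [sub_mul, Finset.sum_sub_distrib]
    rw [key, key]
    simp_rw [hr', hc']
    ring
  have hpos : ∀ i j, A i j ≠ B i j → 0 < (((A i j : ℕ) : ℤ) - ((B i j : ℕ) : ℤ)) * w i j := by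
    intro i j hij
    by_cases hA : A i j = 0
    · have hB : B i j = 1 := by omega
      have := h0 i j hA
      rw [hA, hB]
      simp only [w, Fin.val_zero, Fin.val_one]
      push_cast
      omega
    · have hA' : A i j = 1 := by omega
      have hB : B i j = 0 := by omega
      have := h1 i j hA
      rw [hA', hB]
      simp only [w, Fin.val_zero, Fin.val_one]
      push_cast
      omega
  have hnn : ∀ i j, 0 ≤ (((A i j : ℕ) : ℤ) - ((B i j : ℕ) : ℤ)) * w i j := by
    intro i j
    by_cases hij : A i j = B i j
    · simp [hij]
    · exact (hpos i j hij).le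
  refine Matrix.ext fun i j => ?_
  by_contra hij
  rw [Finset.sum_eq_zero_iff_of_nonneg fun i _ => Finset.sum_nonneg fun j _ => hnn i j] at hsum
  have h2 := hsum i (Finset.mem_univ i)
  rw [Finset.sum_eq_zero_iff_of_nonneg fun j _ => hnn i j] at h2
  exact (hpos i j (Ne.symm hij)).ne' (h2 j (Finset.mem_univ j))

end Lonesum

/-! ### Matrix decompositions in terms of blocks -/

section BlockClass

variable {α β : Type}

/-- A family of blocks meeting every nonempty row contains all blocks, because blocks sharing a row
coincide. -/
theorem blockClass_iff [Finite α] [Finite β] {r : α → β → Prop} {k : ℕ} :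
    (blockClass k).holds r ↔ ∃ b : Fin k → Finset α × Finset β, Function.Injective b ∧
      (∀ κ, IsBlock r (b κ)) ∧ ∀ i j, r i j → ∃ κ, i ∈ (b κ).1 := by
  constructor
  · rintro ⟨h, hk⟩
    let e : {p // IsBlock r p} ≃ Fin k := Finite.equivFinOfCardEq hk
    refine ⟨fun κ => e.symm κ, Subtype.val_injective.comp e.symm.injective,
      fun κ => (e.symm κ).2, fun i j hij => ?_⟩
    obtain ⟨p, hp, hi⟩ := h i j hij
    exact ⟨e ⟨p, hp⟩, by simpa using hi⟩
  · rintro ⟨b, hb, hblock, hcov⟩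
    refine ⟨fun i j hij => ?_, ?_⟩
    · obtain ⟨κ, hκ⟩ := hcov i j hij
      exact ⟨b κ, hblock κ, hκ⟩
    · have : {p | IsBlock r p} = b '' Set.univ := by
        rw [Set.image_univ]
        ext p
        constructor
        · intro hp
          obtain ⟨i, hi⟩ := hp.nonempty
          obtain ⟨j, hj⟩ := hp.row i hi
          obtain ⟨κ, hκ⟩ := hcov i j hj
          exact ⟨κ, (hblock κ).eq_of_mem hp hκ hi⟩
        · rintro ⟨κ, rfl⟩
          exact hblock κ
      rw [this, Set.ncard_image_of_injective _ hb, Set.ncard_univ, Nat.card_fin]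

theorem covered_iff_exists {r : α → β → Prop} :
    Covered r ↔ ∃ k, (blockClass k).holds r :=
  ⟨fun h => ⟨_, h, rfl⟩, fun ⟨_, h⟩ => h.1⟩

theorem PermEquiv.holds {α' β' : Type} {A : BinMatrix α β} {B : BinMatrix α' β'}
    (h : PermEquiv A B) (F : RelClass) (hB : F.holds (rel B)) : F.holds (rel A) := by
  obtain ⟨e, f, rfl⟩ := h
  exact F.iso e f _ hB

theorem permEquiv_of_submatrix {α' β' : Type} {A : BinMatrix α β} {B : BinMatrix α' β'}
    (e : α' ≃ α) (f : β' ≃ β) (h : A.submatrix e f = B) : PermEquiv A B :=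
  ⟨e.symm, f.symm, by rw [← h]; simp⟩

/-- A finite type can be enumerated in the order of decreasing weight. -/
theorem exists_equiv_antitone {γ : Type} [Finite γ] (w : γ → ℕ) :
    ∃ g : Fin (Nat.card γ) ≃ γ, Antitone (w ∘ g) := by
  let e := (Finite.equivFin γ).symm
  refine ⟨(Tuple.sort fun a => OrderDual.toDual (w (e a))).trans e, fun a b hab => ?_⟩
  exact Tuple.monotone_sort (fun a => OrderDual.toDual (w (e a))) hab

theorem nested_of_isFerrers {p q : ℕ} {F : BinMatrix (Fin p) (Fin q)} (h : IsFerrers F) :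
    Nested (rel F) := by
  intro i i' j j' h1 h2
  rcases le_total i i' with hi | hi
  · exact Or.inl fun h0 => h2 ((h i j' h0).1 i' hi)
  · exact Or.inr fun h0 => h1 ((h i' j h0).1 i hi)

theorem Nested.eq_zero_of_le [Finite α] {γ : Type} [Preorder γ] {A : BinMatrix γ α}
    (h : Nested (rel A)) (hw : Antitone fun i => {j | rel A i j}.ncard) {i i' : γ}
    (hi : i ≤ i') {j : α} (hij : A i j = 0) : A i' j = 0 := by
  by_contra hj
  refine (hw hi).not_gt (Set.ncard_lt_ncard ⟨fun j' hj' => ?_, fun hs => hs hj hij⟩)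
  exact (h i i' j' j hj' hj).resolve_left fun h => h hij

theorem HasDecompositionOrder.holds {m n k : ℕ} {A : BinMatrix (Fin m) (Fin n)}
    (h : HasDecompositionOrder A k) : (blockClass k).holds (rel A) := by
  obtain ⟨p, q, F, r, s, hF, hA⟩ := h
  refine hA.holds _ (blockClass_iff.mpr ?_)
  set R := rel (Matrix.fromBlocks (Matrix.blockDiagonal' F) 0 0 (0 : BinMatrix (Fin r) (Fin s)))
    with hR
  let φ : ∀ κ, Fin (p κ) ↪ (Σ κ, Fin (p κ)) ⊕ Fin r := fun κ =>
    (Function.Embedding.sigmaMk (β := fun κ => Fin (p κ)) κ).trans Function.Embedding.inl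
  let ψ : ∀ κ, Fin (q κ) ↪ (Σ κ, Fin (q κ)) ⊕ Fin s := fun κ =>
    (Function.Embedding.sigmaMk (β := fun κ => Fin (q κ)) κ).trans Function.Embedding.inl
  have hRF : ∀ κ a b, R (φ κ a) (ψ κ b) ↔ rel (F κ) a b := by
    intro κ a b
    simp [hR, rel, φ, ψ, Matrix.blockDiagonal'_apply_eq]
  have hRex : ∀ i j, R i j → ∃ κ a b, i = φ κ a ∧ j = ψ κ b := by
    rintro (⟨κ, a⟩ | i) (⟨κ', b⟩ | j) h
    · by_cases hκ : κ = κ'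
      · subst hκ
        exact ⟨κ, a, b, rfl, rfl⟩
      · simp [hR, rel, Matrix.blockDiagonal'_apply_ne F a b hκ] at h
    · simp [hR, rel] at h
    · simp [hR, rel] at h
    · simp [hR, rel] at h
  have hφ : ∀ κ κ' a, φ κ a ∈ Finset.univ.map (φ κ') ↔ κ' = κ := by
    intro κ κ' a
    simp only [Finset.mem_map, Finset.mem_univ, true_and]
    constructor
    · rintro ⟨a', ha⟩
      have := Sum.inl_injective ha
      exact congrArg Sigma.fst this
    · rintro rfl
      exact ⟨a, rfl⟩
  have hψ : ∀ κ κ' a, ψ κ a ∈ Finset.univ.map (ψ κ') ↔ κ' = κ := by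
    intro κ κ' a
    simp only [Finset.mem_map, Finset.mem_univ, true_and]
    constructor
    · rintro ⟨a', ha⟩
      have := Sum.inl_injective ha
      exact congrArg Sigma.fst this
    · rintro rfl
      exact ⟨a, rfl⟩
  refine ⟨fun κ => (Finset.univ.map (φ κ), Finset.univ.map (ψ κ)), ?_, fun κ => ?_, ?_⟩
  · intro κ κ' h
    have h1 : φ κ ⟨0, (hF κ).1⟩ ∈ Finset.univ.map (φ κ') := by
      have h2 : Finset.univ.map (φ κ) = Finset.univ.map (φ κ') := (Prod.ext_iff.mp h).1
      rw [← h2, hφ]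
    exact ((hφ _ _ _).mp h1).symm
  · refine ⟨?_, ?_, ?_, ?_, ?_⟩
    · intro i j hij
      obtain ⟨κ', a, b, rfl, rfl⟩ := hRex i j hij
      rw [hφ, hψ]
    · exact ⟨φ κ ⟨0, (hF κ).1⟩, by rw [hφ]⟩
    · intro i hi
      obtain ⟨a, -, rfl⟩ := Finset.mem_map.mp hi
      obtain ⟨b, hb⟩ := (hF κ).2.2.2.1 a
      exact ⟨ψ κ b, (hRF κ a b).mpr hb⟩
    · intro j hj
      obtain ⟨b, -, rfl⟩ := Finset.mem_map.mp hj
      obtain ⟨a, ha⟩ := (hF κ).2.2.2.2 b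
      exact ⟨φ κ a, (hRF κ a b).mpr ha⟩
    · intro i hi i' hi' j j' h h'
      obtain ⟨a, -, rfl⟩ := Finset.mem_map.mp hi
      obtain ⟨a', -, rfl⟩ := Finset.mem_map.mp hi'
      obtain ⟨κ₁, c, b, hc, rfl⟩ := hRex _ _ h
      have : κ₁ = κ := (hφ κ κ₁ a).mp (by rw [hc, hφ])
      subst this
      obtain ⟨κ₂, c', b', hc', rfl⟩ := hRex _ _ h'
      have : κ₂ = κ₁ := (hφ κ₁ κ₂ a').mp (by rw [hc', hφ])
      subst this
      rw [hRF] at h h'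
      rw [hRF, hRF]
      exact nested_of_isFerrers (hF κ₂).2.2.1 a a' b b' h h'
  · intro i j hij
    obtain ⟨κ, a, b, rfl, rfl⟩ := hRex i j hij
    exact ⟨κ, by rw [hφ]⟩

/-- Pairwise disjoint finsets and the rest partition a finite type. -/
theorem exists_sigma_sum_equiv {γ : Type} [Finite γ] {k : ℕ} (S : Fin k → Finset γ)
    (hS : ∀ κ κ' i, i ∈ S κ → i ∈ S κ' → κ = κ')
    (g : ∀ κ, Fin (Nat.card (S κ)) ≃ S κ) :
    ∃ (r : ℕ) (e : (Σ κ, Fin (Nat.card (S κ))) ⊕ Fin r ≃ γ),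
      (∀ κ a, e (Sum.inl ⟨κ, a⟩) = g κ a) ∧ ∀ c κ, e (Sum.inr c) ∉ S κ := by
  let h := (Finite.equivFin {i // ∀ κ, i ∉ S κ}).symm
  refine ⟨_, Equiv.ofBijective (Sum.elim (fun a => (g a.1 a.2 : γ)) fun c => (h c : γ))
    ⟨?_, ?_⟩, fun κ a => rfl, fun c => (h c).2⟩
  · rintro (⟨κ, a⟩ | c) (⟨κ', a'⟩ | c') he
    · have he : ((g κ a : γ)) = g κ' a' := he
      have hκ := hS κ κ' _ (g κ a).2 (he ▸ (g κ' a').2)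
      subst hκ
      rw [(g κ).injective (Subtype.ext he)]
    · exact ((h c').2 κ ((show ((g κ a : γ)) = h c' from he) ▸ (g κ a).2)).elim
    · exact ((h c).2 κ' ((show ((g κ' a' : γ)) = h c from he.symm) ▸ (g κ' a').2)).elim
    · rw [h.injective (Subtype.ext he)]
  · intro i
    by_cases hi : ∃ κ, i ∈ S κ
    · obtain ⟨κ, hi⟩ := hi
      exact ⟨Sum.inl ⟨κ, (g κ).symm ⟨i, hi⟩⟩, by simp⟩
    · exact ⟨Sum.inr (h.symm ⟨i, not_exists.mp hi⟩), by simp⟩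

/-- Within each block, rows and columns are listed by decreasing size, which makes a nested relation
Ferrers; rows and columns outside all blocks form the zero corner. -/
theorem hasDecompositionOrder_of_holds {m n k : ℕ} {A : BinMatrix (Fin m) (Fin n)}
    (h : (blockClass k).holds (rel A)) : HasDecompositionOrder A k := by
  obtain ⟨b, hb, hblock, hcov⟩ := blockClass_iff.mp h
  have hA : ∀ {i j}, ¬ rel A i j → A i j = 0 := fun h => not_not.mp h
  have hdis : ∀ κ κ' i, i ∈ (b κ).1 → i ∈ (b κ').1 → κ = κ' := fun κ κ' i h h' =>
    hb ((hblock κ).eq_of_mem (hblock κ') h h')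
  have hdis' : ∀ κ κ' j, j ∈ (b κ).2 → j ∈ (b κ').2 → κ = κ' := by
    intro κ κ' j h h'
    obtain ⟨i, hi⟩ := (hblock κ).col j h
    exact hdis κ κ' i (((hblock κ).closed i j hi).mpr h) (((hblock κ').closed i j hi).mpr h')
  choose g hg using fun κ => exists_equiv_antitone fun i : (b κ).1 =>
    {j : (b κ).2 | rel A i j}.ncard
  choose g' hg' using fun κ => exists_equiv_antitone fun j : (b κ).2 =>
    {i : (b κ).1 | rel A i j}.ncard
  obtain ⟨r, e, he, he'⟩ := exists_sigma_sum_equiv (fun κ => (b κ).1) hdis g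
  obtain ⟨s, f, hf, hf'⟩ := exists_sigma_sum_equiv (fun κ => (b κ).2) hdis' g'
  have hn : ∀ κ, Nested fun (i : (b κ).1) (j : (b κ).2) => rel A i j := fun κ =>
    (isBlock_iff.mp (hblock κ)).2.2.1
  refine ⟨_, _, fun κ => Matrix.of fun a c => A (g κ a) (g' κ c), r, s, fun κ => ⟨?_, ?_, ?_, ?_⟩,
    permEquiv_of_submatrix e f ?_⟩
  · have := (hblock κ).nonempty.to_subtype
    exact Nat.card_pos
  · have := (hblock κ).snd_nonempty.to_subtype
    exact Nat.card_pos
  · have h1 : Nested (rel (Matrix.of fun a c => A (g κ a) (g' κ c))) :=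
      (hn κ).comap (g κ) (g' κ)
    intro a c hac
    refine ⟨fun a' ha' => h1.eq_zero_of_le ?_ ha' hac, fun c' hc' => ?_⟩
    · convert hg κ using 2 with a
      exact Set.ncard_congr' ((g' κ).subtypeEquiv fun c => Iff.rfl)
    · refine Nested.eq_zero_of_le
        (A := (Matrix.of fun a c => A (g κ a) (g' κ c)).transpose) h1.flip ?_ hc' hac
      convert hg' κ using 2 with c
      exact Set.ncard_congr' ((g κ).subtypeEquiv fun a => Iff.rfl)
  · obtain ⟨-, hr, hc⟩ := (isBlock_iff.mp (hblock κ)).2.2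
    constructor
    · intro a
      exact (hr (g κ a)).imp' (g' κ).symm (by simp [rel])
    · intro c
      exact (hc (g' κ c)).imp' (g κ).symm (by simp [rel])
  · refine Matrix.ext ?_
    rintro (⟨κ, a⟩ | i) (⟨κ', c⟩ | j)
    · simp only [Matrix.submatrix_apply, Matrix.fromBlocks_apply₁₁, he, hf]
      by_cases hκ : κ = κ'
      · subst hκ
        rw [Matrix.blockDiagonal'_apply_eq]
        rfl
      · rw [Matrix.blockDiagonal'_apply_ne _ _ _ hκ]
        refine hA fun h => hκ (hdis' κ κ' _ ?_ (g' κ' c).2)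
        exact ((hblock κ).closed _ _ h).mp (g κ a).2
    · simp only [Matrix.submatrix_apply, Matrix.fromBlocks_apply₁₂, he, Matrix.zero_apply]
      exact hA fun h => hf' j κ (((hblock κ).closed _ _ h).mp (g κ a).2)
    all_goals
      simp only [Matrix.submatrix_apply, Matrix.fromBlocks_apply₂₁, Matrix.fromBlocks_apply₂₂,
        Matrix.zero_apply]
      refine hA fun h => ?_
      obtain ⟨κ, hκ⟩ := hcov _ _ h
      exact he' i κ hκ

theorem hasDecompositionOrder_iff {m n k : ℕ} {A : BinMatrix (Fin m) (Fin n)} :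
    HasDecompositionOrder A k ↔ (blockClass k).holds (rel A) :=
  ⟨HasDecompositionOrder.holds, hasDecompositionOrder_of_holds⟩

theorem covered_blockDiagonal' {k : ℕ} {p q : Fin k → ℕ}
    {L : ∀ i, BinMatrix (Fin (p i)) (Fin (q i))} (hL : ∀ i, IsLonesum (L i)) :
    Covered (rel (Matrix.blockDiagonal' L)) := by
  classical
  set R := rel (Matrix.blockDiagonal' L) with hR
  have hR1 : ∀ i j, R i j → i.1 = j.1 := by
    rintro ⟨κ, a⟩ ⟨κ', b⟩ h
    by_contra hκ
    exact h (Matrix.blockDiagonal'_apply_ne L a b hκ)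
  have hR2 : ∀ κ a b, R ⟨κ, a⟩ ⟨κ, b⟩ ↔ rel (L κ) a b := by
    intro κ a b
    rw [hR, rel, rel, Matrix.blockDiagonal'_apply_eq]
  intro i j hij
  -- A lonesum diagonal block may have zero rows or columns, so these are discarded to obtain a
  -- block of the relation.
  refine ⟨(Finset.univ.filter fun i' => i'.1 = i.1 ∧ ∃ j, R i' j,
    Finset.univ.filter fun j' => j'.1 = i.1 ∧ ∃ i, R i j'), ⟨?_, ?_, ?_, ?_, ?_⟩,
    ?_⟩
  · intro a c h
    simp only [Finset.mem_filter_univ]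
    rw [hR1 a c h]
    exact and_congr_right fun _ => iff_of_true ⟨c, h⟩ ⟨a, h⟩
  · exact ⟨i, (Finset.mem_filter_univ i).mpr ⟨rfl, j, hij⟩⟩
  · intro a ha
    exact ((Finset.mem_filter_univ a).mp ha).2
  · intro c hc
    exact ((Finset.mem_filter_univ c).mp hc).2
  · rintro a ha a' ha' c c' h h'
    have e1 := ((Finset.mem_filter_univ a).mp ha).1
    have e2 := ((Finset.mem_filter_univ a').mp ha').1
    have e3 := hR1 _ _ h
    have e4 := hR1 _ _ h'
    obtain ⟨κ, i⟩ := i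
    obtain ⟨κ₁, a⟩ := a
    obtain ⟨κ₂, a'⟩ := a'
    obtain ⟨κ₃, c⟩ := c
    obtain ⟨κ₄, c'⟩ := c'
    dsimp only at e1 e2 e3 e4
    subst e3 e4 e1 e2
    rw [hR2] at h h'
    rw [hR2, hR2]
    exact (hL _).nested a a' c c' h h'
  · exact (Finset.mem_filter_univ i).mpr ⟨rfl, j, hij⟩

theorem isLonesumDecomposable_of_labelling {m n : ℕ} {A : BinMatrix (Fin m) (Fin n)} {k : ℕ}
    (c : Fin m → Fin k) (d : Fin n → Fin k) (h : ∀ i j, rel A i j → c i = d j)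
    (hn : ∀ κ, Nested fun (i : {i // c i = κ}) (j : {j // d j = κ}) => rel A i j) :
    IsLonesumDecomposable A := by
  let g : ∀ κ, Fin _ ≃ {i // c i = κ} := fun κ => (Finite.equivFin _).symm
  let g' : ∀ κ, Fin _ ≃ {j // d j = κ} := fun κ => (Finite.equivFin _).symm
  refine ⟨k, _, _, fun κ => Matrix.of fun a b => A (g κ a) (g' κ b), fun κ => ?_,
    permEquiv_of_submatrix ((Equiv.sigmaCongrRight g).trans (Equiv.sigmaFiberEquiv c))
      ((Equiv.sigmaCongrRight g').trans (Equiv.sigmaFiberEquiv d)) ?_⟩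
  · exact Nested.isLonesum ((hn κ).comap (g κ) (g' κ))
  · refine Matrix.ext ?_
    rintro ⟨κ, a⟩ ⟨κ', b⟩
    by_cases hκ : κ = κ'
    · subst hκ
      rw [Matrix.blockDiagonal'_apply_eq]
      rfl
    · rw [Matrix.blockDiagonal'_apply_ne _ _ _ hκ]
      by_contra h0
      have := h _ _ h0
      exact hκ (((g κ a).2.symm.trans this).trans (g' κ' b).2)

theorem isLonesumDecomposable_iff {m n : ℕ} {A : BinMatrix (Fin m) (Fin n)} :
    IsLonesumDecomposable A ↔ Covered (rel A) := by
  constructor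
  · rintro ⟨k, p, q, L, hL, hA⟩
    obtain ⟨k, hk⟩ := covered_iff_exists.mp (covered_blockDiagonal' hL)
    exact (hA.holds _ hk).1
  · intro h
    obtain ⟨k, hk⟩ := covered_iff_exists.mp h
    obtain ⟨b, hb, hblock, hcov⟩ := blockClass_iff.mp hk
    have hdis : ∀ κ κ' i, i ∈ (b κ).1 → i ∈ (b κ').1 → κ = κ' := fun κ κ' i h h' =>
      hb ((hblock κ).eq_of_mem (hblock κ') h h')
    have hdis' : ∀ κ κ' j, j ∈ (b κ).2 → j ∈ (b κ').2 → κ = κ' := by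
      intro κ κ' j h h'
      obtain ⟨i, hi⟩ := (hblock κ).col j h
      exact hdis κ κ' i (((hblock κ).closed i j hi).mpr h) (((hblock κ').closed i j hi).mpr h')
    have hlabel : ∀ {γ : Type} (S : Fin k → Finset γ),
        (∀ κ κ' i, i ∈ S κ → i ∈ S κ' → κ = κ') →
        -- The extra label `Fin.last k` collects the rows and columns in no block; they form one
        -- more diagonal block, which is zero and hence lonesum.
        ∀ i, ∃ l : Fin (k + 1), ∀ κ, l = Fin.castSucc κ ↔ i ∈ S κ := by
      intro γ S hS i
      by_cases hi : ∃ κ, i ∈ S κ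
      · obtain ⟨κ, hκ⟩ := hi
        refine ⟨Fin.castSucc κ, fun κ' => ?_⟩
        rw [Fin.castSucc_inj]
        exact ⟨fun h => h ▸ hκ, fun h => hS κ κ' i hκ h⟩
      · exact ⟨Fin.last k, fun κ =>
          iff_of_false (Fin.castSucc_ne_last κ).symm (not_exists.mp hi κ)⟩
    choose c hc using hlabel (fun κ => (b κ).1) hdis
    choose d hd using hlabel (fun κ => (b κ).2) hdis'
    refine isLonesumDecomposable_of_labelling c d ?_ ?_
    · intro i j hij
      obtain ⟨κ, hκ⟩ := hcov i j hij
      rw [(hc i κ).mpr hκ, (hd j κ).mpr (((hblock κ).closed i j hij).mp hκ)]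
    · rintro l ⟨i, hi⟩ ⟨i', hi'⟩ ⟨j, hj⟩ ⟨j', hj'⟩ h h'
      obtain ⟨κ, hκ⟩ := hcov i j h
      refine (hblock κ).nested i hκ i' ?_ j j' h h'
      rw [← hc, hi', ← hi, hc]
      exact hκ

end BlockClass

/-! ### Counting and summation over the order -/

theorem numDecomposableOfOrder_eq (k : ℕ) :
    numDecomposableOfOrder k = (blockClass k).count := by
  ext m n
  refine Nat.card_congr (relEquiv.subtypeEquiv fun A => ?_)
  rw [hasDecompositionOrder_iff, isLonesumDecomposable_iff]
  exact ⟨fun h => h.2, fun h => ⟨h.1, h⟩⟩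

theorem numDecomposable_eq (m n : ℕ) :
    numDecomposable m n = Nat.card {r : Fin m → Fin n → Prop // Covered r} :=
  Nat.card_congr (relEquiv.subtypeEquiv fun _ => isLonesumDecomposable_iff)

theorem doubleEGF_numDecomposableOfOrder (k : ℕ) :
    doubleEGF (numDecomposableOfOrder k) =
      MvPowerSeries.C (1 / (k.factorial : ℚ)) * expOf (x + y) * (kernelSeries - 1) ^ k := by
  rw [numDecomposableOfOrder_eq, doubleEGF_blockClass]

theorem hasSum_numDecomposableOfOrder (m n : ℕ) :
    HasSum (fun k => numDecomposableOfOrder k m n) (numDecomposable m n) := by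
  simp_rw [numDecomposableOfOrder_eq, numDecomposable_eq]
  -- A block is a pair of subsets, so fewer than N blocks occur and the sum over k is finite.
  let N := Nat.card (Finset (Fin m) × Finset (Fin n)) + 1
  have hlt : ∀ r : Fin m → Fin n → Prop, {p | IsBlock r p}.ncard < N := fun r =>
    Nat.lt_succ_of_le (by
      rw [← Set.ncard_univ]
      exact Set.ncard_le_ncard (Set.subset_univ _))
  have e : {r : Fin m → Fin n → Prop // Covered r} ≃
      Σ k : Fin N, {r : Fin m → Fin n → Prop // (blockClass k).holds r} :=
    { toFun := fun r => ⟨⟨_, hlt r.1⟩, r.1, r.2, rfl⟩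
      invFun := fun q => ⟨q.2.1, q.2.2.1⟩
      left_inv := fun r => rfl
      right_inv := by
        rintro ⟨⟨k, hk⟩, r, hr, h⟩
        have h' : {p | IsBlock r p}.ncard = k := h
        subst h'
        rfl }
  rw [Nat.card_congr e, Nat.card_sigma, Fin.sum_univ_eq_sum_range
    (fun k => Nat.card {r : Fin m → Fin n → Prop // (blockClass k).holds r})]
  refine hasSum_sum_of_ne_finset_zero fun k hk => ?_
  rw [RelClass.count, Nat.card_eq_zero]
  refine Or.inl ⟨fun r => hk ?_⟩
  rw [Finset.mem_range, ← r.2.2]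
  exact hlt r.1

theorem coeff_pow_eq_zero {f : MvPowerSeries (Fin 2) ℚ}
    (hf : MvPowerSeries.constantCoeff f = 0) {d : Fin 2 →₀ ℕ} {k : ℕ} (hk : d.degree < k) :
    MvPowerSeries.coeff d (f ^ k) = 0 := by
  refine MvPowerSeries.coeff_of_lt_order (lt_of_lt_of_le ?_
    (MvPowerSeries.le_order_pow_of_constantCoeff_eq_zero k hf))
  exact_mod_cast hk

theorem coeff_mul_expOf (E : MvPowerSeries (Fin 2) ℚ) {f : MvPowerSeries (Fin 2) ℚ}
    (hf : MvPowerSeries.constantCoeff f = 0) (d : Fin 2 →₀ ℕ) :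
    MvPowerSeries.coeff d (E * expOf f) =
      ∑ k ∈ Finset.range (d.degree + 1),
        MvPowerSeries.coeff d (MvPowerSeries.C (1 / (k.factorial : ℚ)) * E * f ^ k) := by
  simp_rw [mul_assoc, MvPowerSeries.coeff_C_mul, MvPowerSeries.coeff_mul, Finset.mul_sum]
  rw [Finset.sum_comm]
  refine Finset.sum_congr rfl fun p hp => ?_
  rw [coeff_expOf hf p.2 (d.degree + 1), Finset.mul_sum]
  · exact Finset.sum_congr rfl fun k _ => by ring
  · intro k hk
    refine coeff_pow_eq_zero hf (lt_of_le_of_lt ?_ hk)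
    rw [← Finset.HasAntidiagonal.mem_antidiagonal.mp hp, map_add]
    exact Nat.le_add_left _ _

theorem doubleEGF_numDecomposable :
    doubleEGF numDecomposable = expOf (kernelSeries + x + y - 1) := by
  have hK : MvPowerSeries.constantCoeff (kernelSeries - 1) = 0 := by
    rw [map_sub, constantCoeff_kernelSeries, map_one, sub_self]
  rw [show kernelSeries + x + y - 1 = x + y + (kernelSeries - 1) by ring,
    expOf_add (by simp [x, y]) hK]
  ext d
  rw [coeff_mul_expOf _ hK]
  simp_rw [← doubleEGF_numDecomposableOfOrder, coeff_doubleEGF]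
  rw [← Finset.sum_div]
  congr 1
  rw [← Nat.cast_sum, Nat.cast_inj]
  -- Orders above the total degree contribute nothing: `kernelSeries - 1` has zero constant term, so
  -- its k-th power has no terms of degree below k.
  refine (hasSum_numDecomposableOfOrder _ _).unique (hasSum_sum_of_ne_finset_zero fun k hk => ?_)
  have h : MvPowerSeries.coeff d (doubleEGF (numDecomposableOfOrder k)) = 0 := by
    rw [doubleEGF_numDecomposableOfOrder, MvPowerSeries.coeff_mul]
    refine Finset.sum_eq_zero fun p hp => ?_
    rw [coeff_pow_eq_zero hK, mul_zero]
    rw [Finset.mem_range, not_lt] at hk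
    refine lt_of_le_of_lt ?_ hk
    rw [← Finset.HasAntidiagonal.mem_antidiagonal.mp hp, map_add]
    exact Nat.le_add_left _ _
  rw [coeff_doubleEGF, div_eq_zero_iff] at h
  have h1 : ((d 0).factorial * (d 1).factorial : ℚ) ≠ 0 := by positivity
  exact_mod_cast h.resolve_right h1

end Lonesum

theorem theorem3p1 :
    (∀ k : ℕ,
      Lonesum.doubleEGF (Lonesum.numDecomposableOfOrder k) =
        MvPowerSeries.C (1 / (k.factorial : ℚ)) * Lonesum.expOf (Lonesum.x + Lonesum.y) *
          (Lonesum.kernelSeries - 1) ^ k) ∧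
    (∀ m n : ℕ,
      HasSum (fun k : ℕ => Lonesum.numDecomposableOfOrder k m n)
        (Lonesum.numDecomposable m n)) ∧
    Lonesum.doubleEGF Lonesum.numDecomposable =
      Lonesum.expOf (Lonesum.kernelSeries + Lonesum.x + Lonesum.y - 1) :=
  ⟨Lonesum.doubleEGF_numDecomposableOfOrder, Lonesum.hasSum_numDecomposableOfOrder,
    Lonesum.doubleEGF_numDecomposable⟩
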